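/- Let $(\mathcal C,\otimes,\mathbb I)$ be a symmetric monoidal category that is locally presentable, and let $(F,\nabla,\eta)$ be an accessible lax symmetric monoidal endofunctor of $\mathcal C$. Write $\mathsf{Alg}$ and $\mathsf{CoAlg}$ for the categories of algebras $FA\to A$ and coalgebras $C\to FC$ of the endofunctor $F$. For a coalgebra $(C,\chi)$ and algebras $(A,\alpha)$, $(B,\beta)$, a \emph{measuring} from $A$ to $B$ by $C$ is a morphism $\phi\colon C\otimes A\to B$ of $\mathcal C$ with $$\beta\circ F(\phi)\circ\nabla_{C,A}\circ(\chi\otimes\mathrm{id}_{FA})=\phi\circ(\mathrm{id}_C\otimes\alpha)\colon C\otimes FA\to B .$$ The set of these is denoted $\mu_C(A,B)$; composition with homomorphisms makes $\mu$ a functor $\mathsf{CoAlg}^{\mathrm{op}}\times\mathsf{Alg}^{\mathrm{op}}\times\mathsf{Alg}\to\mathsf{Set}$. Theorem. The forgetful functor $\mathsf{Alg}\to\mathcal C$ has a left adjoint. Let $\mathsf{Fr}$ be any left adjoint, with unit $i$, and write $\alpha_{\mathsf{Fr}}$ for the algebra structure of $\mathsf{Fr}(C\otimes A)$. For every coalgebra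 $(C,\chi)$ and every algebra $(A,\alpha)$, the coequalizer in $\mathsf{Alg}$ $$\mathsf{Fr}(C\otimes FA)\rightrightarrows\mathsf{Fr}(C\otimes A)\xrightarrow{\ q\ }C\triangleright A$$ exists, where one of the two parallel homomorphisms is $\mathsf{Fr}(\mathrm{id}_C\otimes\alpha)$ and the other is the adjunct of $$\alpha_{\mathsf{Fr}}\circ F(i_{C\otimes A})\circ\nabla_{C,A}\circ(\chi\otimes\mathrm{id}_{FA})\colon C\otimes FA\to\mathsf{Fr}(C\otimes A).$$ The functor $\mu_C(A,-)\colon\mathsf{Alg}\to\mathsf{Set}$ is represented by $C\triangleright A$. More precisely, with the functoriality of $\triangleright$ induced from that of $\mathsf{Fr}(C\otimes A)$, there is a bijection $$\mu_C(A,B)\cong\mathsf{Alg}(C\triangleright A,B),$$ natural in $C$, $A$ and $B$, under which a measuring $\phi$ corresponds to the unique homomorphism $f\colon C\triangleright A\to B$ such that the adjunct of $f\circ q$ is $\phi$, i.e. $f\circ q\circ i_{C\otimes A}=\phi$ in $\mathcal C$. -/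

import Mathlib

open CategoryTheory Limits MonoidalCategory Opposite

universe v u

namespace MeasuringTensor

open Endofunctor

variable {𝒞 : Type u} [Category.{v} 𝒞] [MonoidalCategory 𝒞] {F : 𝒞 ⥤ 𝒞} [F.LaxMonoidal]

/-- A map `φ : C ⊗ A ⟶ B` is a measuring from the algebra `A` to the algebra `B` by the
coalgebra `C` if the two composites `C ⊗ F A ⟶ B`, namely
`C ⊗ F A ⟶ F C ⊗ F A ⟶ F (C ⊗ A) ⟶ F B ⟶ B` and `C ⊗ F A ⟶ C ⊗ A ⟶ B`, agree. -/
def IsMeasuring (C : Coalgebra F) (A B : Algebra F) (φ : C.V ⊗ A.a ⟶ B.a) : Prop :=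
  C.str ▷ F.obj A.a ≫ Functor.LaxMonoidal.μ F C.V A.a ≫ F.map φ ≫ B.str =
    C.V ◁ A.str ≫ φ

/-- The set `μ_C(A, B)` of measurings from `A` to `B` by `C`. -/
structure Measuring (C : Coalgebra F) (A B : Algebra F) : Type v where
  /-- the underlying morphism of a measuring -/
  hom : C.V ⊗ A.a ⟶ B.a
  /-- the compatibility with the structure maps -/
  isMeasuring : IsMeasuring C A B hom

theorem Measuring.ext {C : Coalgebra F} {A B : Algebra F} {φ ψ : Measuring C A B}
    (h : φ.hom = ψ.hom) : φ = ψ := by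
  cases φ; cases ψ; cases h; rfl

/-- Measurings are stable under composition with homomorphisms in all three variables. -/
theorem IsMeasuring.comp {C C' : Coalgebra F} {A A' B B' : Algebra F} {φ : C.V ⊗ A.a ⟶ B.a}
    (h : IsMeasuring C A B φ) (c : C' ⟶ C) (a : A' ⟶ A) (b : B ⟶ B') :
    IsMeasuring C' A' B' ((c.f ⊗ₘ a.f) ≫ φ ≫ b.f) := by
  unfold IsMeasuring at h ⊢
  have hc := c.h
  have ha := a.h
  have hb := b.h
  calc C'.str ▷ F.obj A'.a ≫ Functor.LaxMonoidal.μ F C'.V A'.a ≫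
        F.map ((c.f ⊗ₘ a.f) ≫ φ ≫ b.f) ≫ B'.str
      = (C'.str ≫ F.map c.f) ▷ F.obj A'.a ≫ F.obj C.V ◁ F.map a.f ≫
          Functor.LaxMonoidal.μ F C.V A.a ≫ F.map φ ≫ (F.map b.f ≫ B'.str) := by
        rw [F.map_comp, F.map_comp]
        simp only [Category.assoc, comp_whiskerRight,
          ← Functor.LaxMonoidal.μ_natural_assoc]
        simp only [Category.assoc, MonoidalCategory.tensorHom_def]
    _ = c.f ▷ F.obj A'.a ≫ C.V ◁ F.map a.f ≫ (C.str ▷ F.obj A.a ≫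
          Functor.LaxMonoidal.μ F C.V A.a ≫ F.map φ ≫ B.str) ≫ b.f := by
        rw [hc, hb]
        simp only [Category.assoc, comp_whiskerRight, whisker_exchange_assoc]
    _ = C'.V ◁ A'.str ≫ (c.f ⊗ₘ a.f) ≫ φ ≫ b.f := by
        rw [h]
        simp only [Category.assoc, MonoidalCategory.tensorHom_def, whisker_exchange_assoc,
          ← MonoidalCategory.whiskerLeft_comp_assoc, ha]

/-- The action of homomorphisms `C' ⟶ C`, `A' ⟶ A`, `B ⟶ B'` on measurings. -/
def Measuring.comp {C C' : Coalgebra F} {A A' B B' : Algebra F}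
    (c : C' ⟶ C) (a : A' ⟶ A) (b : B ⟶ B') (φ : Measuring C A B) : Measuring C' A' B' :=
  ⟨(c.f ⊗ₘ a.f) ≫ φ.hom ≫ b.f, φ.isMeasuring.comp c a b⟩

theorem Measuring.comp_id {C : Coalgebra F} {A B : Algebra F} (φ : Measuring C A B) :
    Measuring.comp (𝟙 C) (𝟙 A) (𝟙 B) φ = φ :=
  Measuring.ext (by simp [Measuring.comp])

theorem Measuring.comp_comp {C C' C'' : Coalgebra F} {A A' A'' B B' B'' : Algebra F}
    (c : C' ⟶ C) (a : A' ⟶ A) (b : B ⟶ B') (c' : C'' ⟶ C') (a' : A'' ⟶ A') (b' : B' ⟶ B'')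
    (φ : Measuring C A B) :
    Measuring.comp c' a' b' (Measuring.comp c a b φ) =
      Measuring.comp (c' ≫ c) (a' ≫ a) (b ≫ b') φ :=
  Measuring.ext (by simp [Measuring.comp])

variable (F) in
/-- The functor `μ : CoAlgᵒᵖ × Algᵒᵖ × Alg ⥤ Set`, `(C, A, B) ↦ μ_C(A, B)`, in curried form. -/
def measuringFunctor : (Coalgebra F)ᵒᵖ ⥤ (Algebra F)ᵒᵖ ⥤ Algebra F ⥤ Type v where
  obj C :=
    { obj := fun A =>
        { obj := fun B => Measuring C.unop A.unop B
          map := fun b => ↾(Measuring.comp (𝟙 C.unop) (𝟙 A.unop) b)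
          map_id := fun B => by ext φ; exact Measuring.comp_id φ
          map_comp := fun b b' => by ext φ; simp [Measuring.comp_comp] }
      map := fun a =>
        { app := fun B => ↾(Measuring.comp (𝟙 C.unop) a.unop (𝟙 B))
          naturality := fun B B' b => by ext φ; simp [Measuring.comp_comp] }
      map_id := fun A => by ext B φ; exact Measuring.comp_id φ
      map_comp := fun a a' => by ext B φ; simp [Measuring.comp_comp] }
  map c :=
    { app := fun A =>
        { app := fun B => ↾(Measuring.comp c.unop (𝟙 A.unop) (𝟙 B))
          naturality := fun B B' b => by ext φ; simp [Measuring.comp_comp] }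
      naturality := fun A A' a => by ext B φ; simp [Measuring.comp_comp] }
  map_id C := by ext A B φ; exact Measuring.comp_id φ
  map_comp c c' := by ext A B φ; simp [Measuring.comp_comp]

section Tensor

variable {Fr : 𝒞 ⥤ Algebra F} (adj : Fr ⊣ Algebra.forget F)

/-- The homomorphism `Fr (id ⊗ α) : Fr (C ⊗ F A) ⟶ Fr (C ⊗ A)`. -/
def freeStr (Fr : 𝒞 ⥤ Algebra F) (C : Coalgebra F) (A : Algebra F) :
    Fr.obj (C.V ⊗ F.obj A.a) ⟶ Fr.obj (C.V ⊗ A.a) :=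
  Fr.map (C.V ◁ A.str)

/-- The unit `X ⟶ Fr X` of the free-forgetful adjunction. -/
def freeUnit (X : 𝒞) : X ⟶ (Fr.obj X).a :=
  adj.unit.app X

/-- The homomorphism `Fr (C ⊗ F A) ⟶ Fr (C ⊗ A)` adjunct to the composite
`C ⊗ F A ⟶ F C ⊗ F A ⟶ F (C ⊗ A) ⟶ F (Fr (C ⊗ A)) ⟶ Fr (C ⊗ A)`. -/
def freeTwist (C : Coalgebra F) (A : Algebra F) :
    Fr.obj (C.V ⊗ F.obj A.a) ⟶ Fr.obj (C.V ⊗ A.a) :=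
  (adj.homEquiv (C.V ⊗ F.obj A.a) (Fr.obj (C.V ⊗ A.a))).symm
    (C.str ▷ F.obj A.a ≫ Functor.LaxMonoidal.μ F C.V A.a ≫
      F.map (freeUnit adj (C.V ⊗ A.a)) ≫ (Fr.obj (C.V ⊗ A.a)).str)

set_option linter.unusedSectionVars false in
theorem freeStr_naturality (Fr : 𝒞 ⥤ Algebra F) {C C' : Coalgebra F} {A A' : Algebra F} (c : C ⟶ C') (a : A ⟶ A') :
    freeStr Fr C A ≫ Fr.map (c.f ⊗ₘ a.f) =
      Fr.map (c.f ⊗ₘ F.map a.f) ≫ freeStr Fr C' A' := by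
  have ha := a.h
  simp only [freeStr, ← Fr.map_comp, MonoidalCategory.tensorHom_def, Category.assoc,
    ← MonoidalCategory.whiskerLeft_comp, ha, whisker_exchange_assoc]

theorem freeTwist_naturality {C C' : Coalgebra F} {A A' : Algebra F} (c : C ⟶ C') (a : A ⟶ A') :
    freeTwist adj C A ≫ Fr.map (c.f ⊗ₘ a.f) =
      Fr.map (c.f ⊗ₘ F.map a.f) ≫ freeTwist adj C' A' := by
  have hc := c.h
  have hu : (c.f ⊗ₘ a.f) ≫ freeUnit adj (C'.V ⊗ A'.a) =
      freeUnit adj (C.V ⊗ A.a) ≫ (Fr.map (c.f ⊗ₘ a.f)).f :=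
    adj.unit.naturality (c.f ⊗ₘ a.f)
  have hh := (Fr.map (c.f ⊗ₘ a.f)).h
  unfold freeTwist
  rw [← Adjunction.homEquiv_naturality_right_symm, ← Adjunction.homEquiv_naturality_left_symm]
  congr 1
  calc (C.str ▷ F.obj A.a ≫ Functor.LaxMonoidal.μ F C.V A.a ≫
        F.map (freeUnit adj (C.V ⊗ A.a)) ≫ (Fr.obj (C.V ⊗ A.a)).str) ≫
          (Fr.map (c.f ⊗ₘ a.f)).f
      = C.str ▷ F.obj A.a ≫ Functor.LaxMonoidal.μ F C.V A.a ≫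
        F.map (freeUnit adj (C.V ⊗ A.a) ≫ (Fr.map (c.f ⊗ₘ a.f)).f) ≫
          (Fr.obj (C'.V ⊗ A'.a)).str := by
        rw [F.map_comp]
        simp only [Category.assoc, hh]
    _ = (C.str ≫ F.map c.f) ▷ F.obj A.a ≫ F.obj C'.V ◁ F.map a.f ≫
          Functor.LaxMonoidal.μ F C'.V A'.a ≫
        F.map (freeUnit adj (C'.V ⊗ A'.a)) ≫ (Fr.obj (C'.V ⊗ A'.a)).str := by
        rw [← hu, F.map_comp]
        simp only [Category.assoc, comp_whiskerRight,
          ← Functor.LaxMonoidal.μ_natural_assoc]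
        simp only [Category.assoc, MonoidalCategory.tensorHom_def]
    _ = _ := by
        rw [hc]
        simp only [Category.assoc, comp_whiskerRight, whisker_exchange_assoc,
          MonoidalCategory.tensorHom_def]
        rfl

variable [∀ (C : Coalgebra F) (A : Algebra F), HasCoequalizer (freeStr Fr C A) (freeTwist adj C A)]

/-- The measuring tensor `C ▷ A`, the coequalizer of `Fr (C ⊗ F A) ⇉ Fr (C ⊗ A)`. -/
noncomputable def measuringTensor (C : Coalgebra F) (A : Algebra F) : Algebra F :=
  coequalizer (freeStr Fr C A) (freeTwist adj C A)

/-- The canonical homomorphism `Fr (C ⊗ A) ⟶ C ▷ A`. -/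
noncomputable def measuringTensorπ (C : Coalgebra F) (A : Algebra F) :
    Fr.obj (C.V ⊗ A.a) ⟶ measuringTensor adj C A :=
  coequalizer.π (freeStr Fr C A) (freeTwist adj C A)

instance (C : Coalgebra F) (A : Algebra F) : Epi (measuringTensorπ adj C A) :=
  inferInstanceAs (Epi (coequalizer.π _ _))

theorem measuringTensorπ_condition (C : Coalgebra F) (A : Algebra F) :
    freeStr Fr C A ≫ measuringTensorπ adj C A = freeTwist adj C A ≫ measuringTensorπ adj C A :=
  coequalizer.condition _ _

/-- The homomorphism `C ▷ A ⟶ C' ▷ A'` induced by `C ⟶ C'` and `A ⟶ A'`. -/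
noncomputable def measuringTensorMap {C C' : Coalgebra F} {A A' : Algebra F} (c : C ⟶ C') (a : A ⟶ A') :
    measuringTensor adj C A ⟶ measuringTensor adj C' A' :=
  coequalizer.desc (Fr.map (c.f ⊗ₘ a.f) ≫ measuringTensorπ adj C' A') (by
    rw [← Category.assoc, ← Category.assoc, freeStr_naturality, freeTwist_naturality,
      Category.assoc, Category.assoc, measuringTensorπ_condition])


theorem measuringTensorπ_map {C C' : Coalgebra F} {A A' : Algebra F} (c : C ⟶ C') (a : A ⟶ A') :
    measuringTensorπ adj C A ≫ measuringTensorMap adj c a = Fr.map (c.f ⊗ₘ a.f) ≫ measuringTensorπ adj C' A' :=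
  coequalizer.π_desc _ _

theorem measuringTensorMap_id (C : Coalgebra F) (A : Algebra F) :
    measuringTensorMap adj (𝟙 C) (𝟙 A) = 𝟙 (measuringTensor adj C A) := by
  rw [← cancel_epi (measuringTensorπ adj C A), measuringTensorπ_map]
  simp

theorem measuringTensorMap_comp {C C' C'' : Coalgebra F} {A A' A'' : Algebra F}
    (c : C ⟶ C') (c' : C' ⟶ C'') (a : A ⟶ A') (a' : A' ⟶ A'') :
    measuringTensorMap adj c a ≫ measuringTensorMap adj c' a' = measuringTensorMap adj (c ≫ c') (a ≫ a') := by
  rw [← cancel_epi (measuringTensorπ adj C A), ← Category.assoc, measuringTensorπ_map, measuringTensorπ_map,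
    Category.assoc, measuringTensorπ_map, ← Category.assoc, ← Fr.map_comp]
  simp

/-- The functor `▷ : CoAlg × Alg ⥤ Alg`, in curried form. -/
noncomputable def measuringTensorFunctor : Coalgebra F ⥤ Algebra F ⥤ Algebra F where
  obj C :=
    { obj := fun A => measuringTensor adj C A
      map := fun a => measuringTensorMap adj (𝟙 C) a
      map_id := fun A => measuringTensorMap_id adj C A
      map_comp := fun a a' => by simp [measuringTensorMap_comp] }
  map c :=
    { app := fun A => measuringTensorMap adj c (𝟙 A)
      naturality := fun A A' a => by simp [measuringTensorMap_comp] }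
  map_id C := by ext A : 2; exact measuringTensorMap_id adj C A
  map_comp c c' := by ext A : 2; simp [measuringTensorMap_comp]

/-- The functor `CoAlgᵒᵖ × Algᵒᵖ × Alg ⥤ Set`, `(C, A, B) ↦ Alg(C ▷ A, B)`, in curried form. -/
noncomputable def measuringTensorHomFunctor :
    (Coalgebra F)ᵒᵖ ⥤ (Algebra F)ᵒᵖ ⥤ Algebra F ⥤ Type v :=
  (measuringTensorFunctor adj).op ⋙ Functor.opHom (Algebra F) (Algebra F) ⋙
    (Functor.whiskeringRight _ _ _).obj coyoneda

end Tensor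

end MeasuringTensor

open MeasuringTensor

/-! Under the free-forgetful adjunction the measuring equation says exactly that the adjunct
homomorphism coequalizes the two parallel maps (`isMeasuring_homEquiv_iff`). Given free algebras and
coequalizers of algebras, representability is therefore formal. The substance is that an accessible
endofunctor of a cocomplete category has both.

Both follow from algebras being reflective in partial algebras `F base ⟶ top ⟵ base`, whose colimits
and free objects are explicit. To reflect, extend the action freely by one step (`succ`), which maps
into algebras cannot detect (`isLocal_toSucc`), and iterate along a regular cardinal `κ` such that
`F` preserves `κ`-filtered colimits. Each `top` is the next `base`, so in the colimit the two agree
and `j` is invertible (`isTotal_iteration`). -/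

namespace CategoryTheory.Endofunctor

/-! ### Partial algebras and the embedding of algebras. -/

variable {C : Type u} [Category.{v} C]

/-- A partial algebra of an endofunctor `F`: an object `base` with a map `j` to an object `top`,
and an action `F base ⟶ top`. Algebras are the partial algebras for which `j` is invertible. -/
structure PartialAlgebra (F : C ⥤ C) where
  /-- the object on which the action is defined -/
  base : C
  /-- the object in which the action takes values -/
  top : C
  /-- the partial action -/
  str : F.obj base ⟶ top
  /-- the comparison map -/
  j : base ⟶ top

namespace PartialAlgebra

variable {F : C ⥤ C}

/-- Morphisms of partial algebras. -/
@[ext]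
structure Hom (P Q : PartialAlgebra F) where
  /-- the map on the domains of definition -/
  base : P.base ⟶ Q.base
  /-- the map on the codomains -/
  top : P.top ⟶ Q.top
  str : F.map base ≫ Q.str = P.str ≫ top := by cat_disch
  j : base ≫ Q.j = P.j ≫ top := by cat_disch

attribute [simp] Hom.str Hom.j

@[simp]
lemma Hom.str_assoc {P Q : PartialAlgebra F} (f : Hom P Q) {Z : C} (g : Q.top ⟶ Z) :
    F.map f.base ≫ Q.str ≫ g = P.str ≫ f.top ≫ g := by
  rw [← Category.assoc, f.str, Category.assoc]

@[simp]
lemma Hom.j_assoc {P Q : PartialAlgebra F} (f : Hom P Q) {Z : C} (g : Q.top ⟶ Z) :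
    f.base ≫ Q.j ≫ g = P.j ≫ f.top ≫ g := by
  rw [← Category.assoc, f.j, Category.assoc]

instance : Category (PartialAlgebra F) where
  Hom := Hom
  id P := { base := 𝟙 _, top := 𝟙 _ }
  comp f g := { base := f.base ≫ g.base, top := f.top ≫ g.top }

@[ext]
lemma hom_ext {P Q : PartialAlgebra F} {f g : P ⟶ Q} (h₁ : f.base = g.base)
    (h₂ : f.top = g.top) : f = g :=
  Hom.ext h₁ h₂

@[simp] lemma id_base (P : PartialAlgebra F) : Hom.base (𝟙 P) = 𝟙 P.base := rfl

@[simp] lemma id_top (P : PartialAlgebra F) : Hom.top (𝟙 P) = 𝟙 P.top := rfl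

@[simp] lemma comp_base {P Q R : PartialAlgebra F} (f : P ⟶ Q) (g : Q ⟶ R) :
    (f ≫ g).base = f.base ≫ g.base := rfl

@[simp] lemma comp_top {P Q R : PartialAlgebra F} (f : P ⟶ Q) (g : Q ⟶ R) :
    (f ≫ g).top = f.top ≫ g.top := rfl

variable (F) in
/-- The functor `base`. -/
@[simps]
abbrev baseFunctor : PartialAlgebra F ⥤ C where
  obj P := P.base
  map f := f.base

variable (F) in
/-- The functor `top`. -/
@[simps]
abbrev topFunctor : PartialAlgebra F ⥤ C where
  obj P := P.top
  map f := f.top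

variable (F) in
/-- Algebras as partial algebras. -/
@[simps]
abbrev ofAlgebra : Algebra F ⥤ PartialAlgebra F where
  obj A := { base := A.a, top := A.a, str := A.str, j := 𝟙 _ }
  map f := { base := f.f, top := f.f }

instance : (ofAlgebra F).Faithful where
  map_injective h := by
    ext
    exact congr_arg Hom.base h

/-- Both comparison maps are identities, so compatibility with `j` forces the two components to
coincide. -/
instance : (ofAlgebra F).Full where
  map_surjective {A B} g := by
    have hj : g.base = g.top := by simpa using g.j
    have hs := g.str
    refine ⟨⟨g.top, ?_⟩, ?_⟩
    · rw [hj] at hs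
      exact hs
    · ext
      · exact hj.symm
      · rfl

variable (F) in
/-- The partial algebras which are algebras. -/
def isTotal : ObjectProperty (PartialAlgebra F) := fun P ↦ IsIso P.j

lemma isTotal_ofAlgebra (A : Algebra F) : isTotal F ((ofAlgebra F).obj A) :=
  inferInstanceAs (IsIso (𝟙 _))

/-- The algebra given by a partial algebra for which `j` is invertible. -/
noncomputable abbrev toAlgebra (P : PartialAlgebra F) [IsIso P.j] : Algebra F where
  a := P.top
  str := F.map (inv P.j) ≫ P.str

/-- A partial algebra for which `j` is invertible comes from an algebra. -/
noncomputable def isoOfAlgebra (P : PartialAlgebra F) [IsIso P.j] :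
    P ≅ (ofAlgebra F).obj P.toAlgebra where
  hom :=
    { base := P.j
      top := 𝟙 _
      str := by simp }
  inv :=
    { base := inv P.j
      top := 𝟙 _ }
  hom_inv_id := by
    ext <;> simp
  inv_hom_id := by
    ext <;> simp

/-! ### Colimits of partial algebras. -/

section Colimits

variable {J : Type*} [Category* J] [HasPushouts C] (D : J ⥤ PartialAlgebra F)

/-- The natural transformation given by `str`. -/
@[simps]
abbrev strNatTrans : baseFunctor F ⋙ F ⟶ topFunctor F where
  app P := P.str

/-- The natural transformation given by `j`. -/
@[simps]
abbrev jNatTrans : baseFunctor F ⟶ topFunctor F where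
  app P := P.j

variable {D} {cX : Cocone (D ⋙ baseFunctor F)} (hX : IsColimit cX)
  {cY : Cocone (D ⋙ topFunctor F)} (hY : IsColimit cY)
  {cF : Cocone ((D ⋙ baseFunctor F) ⋙ F)} (hF : IsColimit cF)

/-- The colimit of a diagram of partial algebras. -/
noncomputable abbrev colimitCocone (cY : Cocone (D ⋙ topFunctor F)) : Cocone D where
  pt :=
    { base := cX.pt
      -- The diagram only yields an action on the colimit of the `F base`; the pushout extends it
      -- freely to `F` of the colimit of the bases.
      top := pushout (hF.desc (F.mapCocone cX))
        (hF.desc ((Cocone.precompose (Functor.whiskerLeft D (strNatTrans (F := F)))).obj cY))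
      str := pushout.inl _ _
      j := hX.desc ((Cocone.precompose (Functor.whiskerLeft D (jNatTrans (F := F)))).obj cY) ≫
        pushout.inr _ _ }
  ι :=
    { app i :=
        { base := cX.ι.app i
          top := cY.ι.app i ≫ pushout.inr _ _
          str := by
            have h₁ := hF.fac (F.mapCocone cX) i
            have h₂ := hF.fac
              ((Cocone.precompose (Functor.whiskerLeft D (strNatTrans (F := F)))).obj cY) i
            dsimp at h₁ h₂ ⊢
            rw [← h₁, Category.assoc, pushout.condition, reassoc_of% h₂]
          j := by
            have h := hX.fac
              ((Cocone.precompose (Functor.whiskerLeft D (jNatTrans (F := F)))).obj cY) i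
            dsimp at h ⊢
            rw [reassoc_of% h] }
      naturality i i' f := by
        have h₁ := cX.w f
        have h₂ := cY.w f
        dsimp at h₁ h₂
        ext
        · simpa using h₁
        · simp [reassoc_of% h₂] }

include hY in
/-- `colimitCocone` is a colimit. -/
noncomputable def isColimitColimitCocone : IsColimit (colimitCocone hX hF cY) where
  desc s :=
    { base := hX.desc ((baseFunctor F).mapCocone s)
      top := pushout.desc (F.map (hX.desc ((baseFunctor F).mapCocone s)) ≫ s.pt.str)
        (hY.desc ((topFunctor F).mapCocone s)) (hF.hom_ext fun i ↦ by
          have h₁ := hF.fac (F.mapCocone cX) i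
          have h₂ := hF.fac
            ((Cocone.precompose (Functor.whiskerLeft D (strNatTrans (F := F)))).obj cY) i
          have h₃ := hX.fac ((baseFunctor F).mapCocone s) i
          have h₄ := hY.fac ((topFunctor F).mapCocone s) i
          dsimp at h₁ h₂ h₃ h₄ ⊢
          rw [reassoc_of% h₁, reassoc_of% h₂, h₄, ← Functor.map_comp_assoc, h₃, Hom.str])
      str := (pushout.inl_desc _ _ _).symm
      j := hX.hom_ext fun i ↦ by
        have h₁ := hX.fac
              ((Cocone.precompose (Functor.whiskerLeft D (jNatTrans (F := F)))).obj cY) i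
        have h₃ := hX.fac ((baseFunctor F).mapCocone s) i
        have h₄ := hY.fac ((topFunctor F).mapCocone s) i
        dsimp [colimitCocone] at h₁ h₃ h₄ ⊢
        rw [reassoc_of% h₃]
        simp only [Category.assoc, pushout.inr_desc]
        rw [reassoc_of% h₁, h₄, Hom.j] }
  fac s i := by
    ext
    · exact hX.fac ((baseFunctor F).mapCocone s) i
    · have h₄ := hY.fac ((topFunctor F).mapCocone s) i
      dsimp at h₄ ⊢
      rw [Category.assoc, pushout.inr_desc, h₄]
  uniq s m hm := by
    have hb : m.base = hX.desc ((baseFunctor F).mapCocone s) :=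
      hX.hom_ext fun i ↦ by
        rw [hX.fac]
        exact congr_arg Hom.base (hm i)
    refine hom_ext hb (pushout.hom_ext ?_ ?_)
    · refine Eq.trans ?_ (pushout.inl_desc _ _ _).symm
      rw [← hb]
      exact m.str.symm
    · refine Eq.trans ?_ (pushout.inr_desc _ _ _).symm
      refine hY.hom_ext fun i ↦ ?_
      rw [hY.fac]
      exact (Category.assoc _ _ _).symm.trans (congr_arg Hom.top (hm i))

instance [HasColimitsOfShape J C] : HasColimitsOfShape J (PartialAlgebra F) where
  has_colimit _ := ⟨_, isColimitColimitCocone (colimit.isColimit _) (colimit.isColimit _)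
    (colimit.isColimit _)⟩

instance [HasColimitsOfShape J C] : PreservesColimitsOfShape J (baseFunctor F) where
  preservesColimit {D} := preservesColimit_of_preserves_colimit_cocone
    (isColimitColimitCocone (colimit.isColimit (D ⋙ baseFunctor F)) (colimit.isColimit _)
      (colimit.isColimit _)) (IsColimit.ofIsoColimit (colimit.isColimit _) (Cocone.ext (Iso.refl _)))

instance [HasColimitsOfShape J C] [PreservesColimitsOfShape J F] :
    PreservesColimitsOfShape J (topFunctor F) where
  preservesColimit {D} := by
    let hX := colimit.isColimit (D ⋙ baseFunctor F)
    let hF := isColimitOfPreserves F hX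
    let hY := colimit.isColimit (D ⋙ topFunctor F)
    -- When `F` preserves the colimit, one leg of the pushout is invertible, so the pushout is just
    -- the colimit of the tops.
    have : IsIso (hF.desc (F.mapCocone (colimit.cocone (D ⋙ baseFunctor F)))) := by
      rw [hF.desc_self]
      infer_instance
    refine preservesColimit_of_preserves_colimit_cocone (isColimitColimitCocone hX hY hF)
      (IsColimit.ofIsoColimit hY (Cocone.ext (asIso (pushout.inr _ _)) ?_))
    intro i
    rfl

end Colimits

/-! ### Extending the action by one step. -/

section Succ

variable [HasPushouts C]

/-- The partial algebra in which the values of the action of `P` are acted upon. -/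
noncomputable abbrev succ (P : PartialAlgebra F) : PartialAlgebra F where
  base := P.top
  top := pushout (F.map P.j) P.str
  str := pushout.inl _ _
  j := pushout.inr _ _

/-- The canonical morphism to `P.succ`. -/
noncomputable abbrev toSucc (P : PartialAlgebra F) : P ⟶ P.succ where
  base := P.j
  top := pushout.inr _ _
  str := pushout.condition

/-- Since `B.j` is invertible, the new base component must be the old top component followed by `inv
B.j`; the action then determines the map on the pushout. -/
lemma isLocal_toSucc (P : PartialAlgebra F) : (isTotal F).isLocal P.toSucc := by
  intro B (hB : IsIso B.j)
  constructor
  · intro g₁ g₂ h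
    have hb (g : P.succ ⟶ B) : g.base = (P.toSucc ≫ g).top ≫ inv B.j := by
      rw [IsIso.eq_comp_inv]
      exact g.j
    have h₁ : g₁.base = g₂.base := by
      rw [hb, hb]
      exact congr_arg (fun k ↦ Hom.top k ≫ inv B.j) h
    refine hom_ext h₁ (pushout.hom_ext ?_ ?_)
    · exact g₁.str.symm.trans ((congr_arg (fun k ↦ F.map k ≫ B.str) h₁).trans g₂.str)
    · exact congr_arg Hom.top h
  · intro g
    have hj : P.j ≫ g.top ≫ inv B.j = g.base := by
      rw [← g.j_assoc, IsIso.hom_inv_id, Category.comp_id]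
    refine ⟨{
      base := g.top ≫ inv B.j
      top := pushout.desc (F.map (g.top ≫ inv B.j) ≫ B.str) g.top (by
        rw [← F.map_comp_assoc, hj, g.str])
      str := (pushout.inl_desc _ _ _).symm
      j := by
        rw [Category.assoc, IsIso.inv_hom_id, Category.comp_id]
        exact (pushout.inr_desc _ _ _).symm }, ?_⟩
    exact hom_ext hj (pushout.inr_desc _ _ _)

/-- The successor structure given by `succ` and `toSucc`. -/
noncomputable abbrev succStruct (P : PartialAlgebra F) :
    SmallObject.SuccStruct (PartialAlgebra F) where
  X₀ := P
  succ := succ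
  toSucc := toSucc

end Succ

/-! ### Transfinite iteration of the extension step. -/

section Iteration

variable {J : Type v} [LinearOrder J] [OrderBot J] [SuccOrder J] [WellFoundedLT J]
  [HasPushouts C] [HasIterationOfShape J (PartialAlgebra F)]

lemma isLocal_ιIteration (P : PartialAlgebra F) :
    (isTotal F).isLocal (P.succStruct.ιIteration J) :=
  (isTotal F).isLocal.transfiniteCompositionsOfShape_le J _
    ⟨(P.succStruct.transfiniteCompositionOfShapeιIteration J).ofLE (by
      rintro _ _ _ ⟨_⟩
      exact isLocal_toSucc _)⟩

/-- If `base` and `top` of the iteration of `toSucc` are computed as colimits,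
then it is an algebra. -/
lemma isTotal_iteration [NoMaxOrder J] [PreservesColimitsOfShape J (baseFunctor F)]
    [PreservesColimitsOfShape J (topFunctor F)] (P : PartialAlgebra F) :
    isTotal F (P.succStruct.iteration J) := by
  let D := P.succStruct.iterationFunctor J
  let R := P.succStruct.iteration J
  let ι (i : J) : D.obj i ⟶ R := (P.succStruct.iterationCocone J).ι.app i
  have hι {i k : J} (f : i ⟶ k) : D.map f ≫ ι k = ι i := (P.succStruct.iterationCocone J).w f
  let e (i : J) : D.obj (Order.succ i) ≅ (D.obj i).succ :=
    P.succStruct.iterationFunctorObjSuccIso i (not_isMax i)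
  have he (i : J) : D.map (homOfLE (Order.le_succ i)) = (D.obj i).toSucc ≫ (e i).inv :=
    P.succStruct.iterationFunctor_map_succ i (not_isMax i)
  -- The top of stage `i` is the base of stage `i + 1`; these maps assemble into the inverse of
  -- `R.j`.
  let s (i : J) : (D.obj i).top ⟶ R.base := (e i).inv.base ≫ (ι (Order.succ i)).base
  have js (i : J) : (D.obj i).j ≫ s i = (ι i).base := by
    have := congr_arg Hom.base (he i =≫ ι (Order.succ i))
    rw [hι] at this
    exact (this.trans (Category.assoc _ _ _)).symm
  have sj (i : J) : s i ≫ R.j = (ι i).top := by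
    have h₁ : (e i).inv.base ≫ (D.obj (Order.succ i)).j =
      (D.map (homOfLE (Order.le_succ i))).top := by
      rw [he]
      exact (e i).inv.j
    rw [← hι (homOfLE (Order.le_succ i)), comp_top, ← h₁]
    simp [s]
  have hs {i k : J} (f : i ⟶ k) : (D.map f).top ≫ s k = s i := by
    obtain h | h := (leOfHom f).lt_or_eq
    · obtain rfl : f = homOfLE (Order.le_succ i) ≫ homOfLE (Order.succ_le_of_lt h) := rfl
      have h₁ : (D.map (homOfLE (Order.le_succ i))).top =
          (e i).inv.base ≫ (D.obj (Order.succ i)).j := by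
        rw [he]
        exact (e i).inv.j.symm
      rw [D.map_comp, comp_top, h₁, Category.assoc, Category.assoc,
        ← Hom.j_assoc, js, ← comp_base, hι]
    · obtain rfl := h
      obtain rfl : f = 𝟙 i := rfl
      simp
  have hX := isColimitOfPreserves (baseFunctor F) (P.succStruct.isColimitIterationCocone J)
  have hY := isColimitOfPreserves (topFunctor F) (P.succStruct.isColimitIterationCocone J)
  let c : Cocone (D ⋙ topFunctor F) :=
    { pt := R.base
      ι := { app := s, naturality := fun i k f ↦ (hs f).trans (Category.comp_id _).symm } }
  obtain ⟨r, hr⟩ : ∃ r : R.top ⟶ R.base, ∀ i, (ι i).top ≫ r = s i := ⟨hY.desc c, hY.fac c⟩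
  refine ⟨r, ?_, ?_⟩
  · refine hX.hom_ext fun i ↦ ?_
    change (ι i).base ≫ R.j ≫ r = (ι i).base ≫ 𝟙 R.base
    rw [Hom.j_assoc, hr, js, Category.comp_id]
  · refine hY.hom_ext fun i ↦ ?_
    change (ι i).top ≫ r ≫ R.j = (ι i).top ≫ 𝟙 R.top
    rw [← Category.assoc, hr, sj, Category.comp_id]

end Iteration

/-! ### Reflection onto algebras and free partial algebras. -/

section Reflection

/-- If each partial algebra has a local morphism to an algebra, then algebras are reflective. -/
lemma isRightAdjoint_ofAlgebra
    (h : ∀ P : PartialAlgebra F, ∃ (R : PartialAlgebra F) (η : P ⟶ R),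
      isTotal F R ∧ (isTotal F).isLocal η) :
    (ofAlgebra F).IsRightAdjoint := by
  rw [Functor.isRightAdjoint_iff_leftAdjointObjIsDefined_eq_top]
  ext P
  obtain ⟨R, η, hR, hη⟩ := h P
  have : IsIso R.j := hR
  let r : (ofAlgebra F ⋙ coyoneda.obj (op P)).CorepresentableBy R.toAlgebra :=
    { homEquiv {B} := ((Functor.FullyFaithful.ofFullyFaithful (ofAlgebra F)).homEquiv.trans
        (R.isoOfAlgebra.symm.homFromEquiv)).trans
        (Equiv.ofBijective _ (hη _ (isTotal_ofAlgebra B)))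
      homEquiv_comp g f := by
        change η ≫ R.isoOfAlgebra.hom ≫ (ofAlgebra F).map (f ≫ g) =
          (η ≫ R.isoOfAlgebra.hom ≫ (ofAlgebra F).map f) ≫ (ofAlgebra F).map g
        rw [Functor.map_comp, Category.assoc, Category.assoc] }
  simpa using! r.isCorepresentable

/-- The free partial algebra on `X` has initial base, so its top only needs `X` and a summand
receiving the action. -/
lemma isRightAdjoint_topFunctor [HasInitial C] [HasBinaryCoproducts C] :
    (topFunctor F).IsRightAdjoint := by
  let free (X : C) : PartialAlgebra F :=
    { base := ⊥_ C
      top := X ⨿ F.obj (⊥_ C)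
      str := coprod.inr
      j := initial.to _ }
  let e (X : C) (P : PartialAlgebra F) : (free X ⟶ P) ≃ (X ⟶ (topFunctor F).obj P) :=
    { toFun f := coprod.inl ≫ f.top
      invFun g :=
        { base := initial.to _
          top := coprod.desc g (F.map (initial.to _) ≫ P.str)
          str := (coprod.inr_desc _ _).symm
          j := initialIsInitial.hom_ext _ _ }
      left_inv f := by
        have h : initial.to _ = f.base := initialIsInitial.hom_ext _ _
        refine hom_ext h (coprod.hom_ext ?_ ?_)
        · exact coprod.inl_desc _ _
        · refine (coprod.inr_desc _ _).trans ?_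
          rw [h]
          exact f.str
      right_inv g := coprod.inl_desc _ _ }
  exact (Adjunction.adjunctionOfEquivLeft (G := topFunctor F) e
    (fun X P P' h g ↦ (Category.assoc _ _ _).symm)).isRightAdjoint

end Reflection

end PartialAlgebra

/-! ### Free algebras and cocompleteness for accessible endofunctors. -/

open PartialAlgebra

variable [HasColimits C] (F : C ⥤ C) [F.IsAccessible.{v}]

/-- Algebras of an accessible endofunctor of a cocomplete category are reflective
in partial algebras. -/
lemma isRightAdjoint_ofAlgebra_of_isAccessible : (ofAlgebra F).IsRightAdjoint := by
  obtain ⟨κ, _, _⟩ := Functor.IsAccessible.exists_cardinal (F := F)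
  have : Nonempty κ.ord.ToType := by simpa using Cardinal.IsRegular.ne_zero Fact.out
  have := WellFoundedLT.toOrderBot κ.ord.ToType
  -- The iteration needs a limit ordinal, and one that is `κ`-filtered so that `F` preserves its
  -- colimits; `κ.ord` is both.
  have := Cardinal.noMaxOrder (Fact.elim inferInstance : κ.IsRegular).aleph0_le
  have := F.preservesColimitsOfShape_of_isCardinalAccessible κ κ.ord.ToType
  have : HasColimits (PartialAlgebra F) := ⟨fun _ _ ↦ inferInstance⟩
  exact isRightAdjoint_ofAlgebra fun P ↦ ⟨_, P.succStruct.ιIteration κ.ord.ToType,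
    P.isTotal_iteration, P.isLocal_ιIteration⟩

/-- The forgetful functor from algebras of an accessible endofunctor of a cocomplete category
has a left adjoint. -/
lemma Algebra.isRightAdjoint_forget : (Algebra.forget F).IsRightAdjoint := by
  have := isRightAdjoint_ofAlgebra_of_isAccessible F
  have := isRightAdjoint_topFunctor (F := F)
  -- This composite is the forgetful functor by definition: free algebras are reflections of free
  -- partial algebras.
  exact inferInstanceAs (ofAlgebra F ⋙ topFunctor F).IsRightAdjoint

/-- The category of algebras of an accessible endofunctor of a cocomplete category
is cocomplete. -/
lemma Algebra.hasColimits : HasColimits (Algebra F) := by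
  have := isRightAdjoint_ofAlgebra_of_isAccessible F
  have : HasColimits (PartialAlgebra F) := ⟨fun _ _ ↦ inferInstance⟩
  let : Reflective (ofAlgebra F) :=
    { L := (ofAlgebra F).leftAdjoint
      adj := Adjunction.ofIsRightAdjoint _ }
  exact hasColimits_of_reflective (ofAlgebra F)

end CategoryTheory.Endofunctor

/-! ### Measurings as homomorphisms out of the coequalizer. -/

namespace MeasuringTensor

open Endofunctor

variable {𝒞 : Type u} [Category.{v} 𝒞] [MonoidalCategory 𝒞] {F : 𝒞 ⥤ 𝒞} [F.LaxMonoidal]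
  {Fr : 𝒞 ⥤ Algebra F} (adj : Fr ⊣ Algebra.forget F)

/-- A morphism `C ⊗ A ⟶ B` is a measuring if and only if its adjunct `Fr (C ⊗ A) ⟶ B`
coequalizes the two homomorphisms `Fr (C ⊗ F A) ⇉ Fr (C ⊗ A)`. -/
lemma isMeasuring_homEquiv_iff (C : Coalgebra F) (A B : Algebra F)
    (g : Fr.obj (C.V ⊗ A.a) ⟶ B) :
    IsMeasuring C A B (adj.homEquiv _ _ g) ↔ freeStr Fr C A ≫ g = freeTwist adj C A ≫ g := by
  rw [← (adj.homEquiv _ _).apply_eq_iff_eq, eq_comm, freeTwist, freeStr,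
    adj.homEquiv_naturality_left, ← adj.homEquiv_naturality_right_symm, Equiv.apply_symm_apply,
    adj.homEquiv_unit]
  -- Because `g` is a homomorphism, the action on `B` can be moved back to the action on the free
  -- algebra.
  have e : C.str ▷ F.obj A.a ≫ Functor.LaxMonoidal.μ F C.V A.a ≫
        F.map (freeUnit adj (C.V ⊗ A.a) ≫ g.f) ≫ B.str =
      (C.str ▷ F.obj A.a ≫ Functor.LaxMonoidal.μ F C.V A.a ≫
        F.map (freeUnit adj (C.V ⊗ A.a)) ≫ (Fr.obj (C.V ⊗ A.a)).str) ≫ g.f := by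
    simp
  exact ⟨fun h ↦ e.symm.trans h, fun h ↦ e.trans h⟩

variable [∀ (C : Coalgebra F) (A : Algebra F), HasCoequalizer (freeStr Fr C A) (freeTwist adj C A)]

/-- Measurings from `A` to `B` by `C` correspond to homomorphisms `C ▷ A ⟶ B`. -/
noncomputable def measuringEquiv (C : Coalgebra F) (A B : Algebra F) :
    Measuring C A B ≃ (measuringTensor adj C A ⟶ B) where
  toFun φ := coequalizer.desc ((adj.homEquiv _ _).symm φ.hom)
    ((isMeasuring_homEquiv_iff adj C A B _).1 (((adj.homEquiv (C.V ⊗ A.a) B).apply_symm_apply φ.hom).symm ▸ φ.isMeasuring))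
  invFun f := ⟨adj.homEquiv _ _ (measuringTensorπ adj C A ≫ f),
    (isMeasuring_homEquiv_iff adj C A B _).2
      (by rw [← Category.assoc, measuringTensorπ_condition, Category.assoc])⟩
  left_inv φ := Measuring.ext (by
    refine (congr_arg (adj.homEquiv _ _) (coequalizer.π_desc _ _)).trans ?_
    exact Equiv.apply_symm_apply _ _)
  right_inv f := by
    refine (cancel_epi (measuringTensorπ adj C A)).1 ((coequalizer.π_desc _ _).trans ?_)
    exact Equiv.symm_apply_apply _ _

lemma measuringEquiv_symm_hom (C : Coalgebra F) (A B : Algebra F)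
    (f : measuringTensor adj C A ⟶ B) :
    ((measuringEquiv adj C A B).symm f).hom =
      adj.homEquiv _ _ (measuringTensorπ adj C A ≫ f) := rfl

/-- Naturality is checked on the inverse, which has a closed formula, and reduces to naturality of
`adj.homEquiv` and of the quotient map. -/
lemma measuringEquiv_symm_comp {C C' : Coalgebra F} {A A' B B' : Algebra F}
    (c : C' ⟶ C) (a : A' ⟶ A) (b : B ⟶ B') (f : measuringTensor adj C A ⟶ B) :
    Measuring.comp c a b ((measuringEquiv adj C A B).symm f) =
      (measuringEquiv adj C' A' B').symm (measuringTensorMap adj c a ≫ f ≫ b) := by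
  apply Measuring.ext
  rw [measuringEquiv_symm_hom, ← Category.assoc, measuringTensorπ_map, Category.assoc,
    adj.homEquiv_naturality_left, ← Category.assoc _ f b, adj.homEquiv_naturality_right]
  rfl

lemma measuringEquiv_comp {C C' : Coalgebra F} {A A' B B' : Algebra F}
    (c : C' ⟶ C) (a : A' ⟶ A) (b : B ⟶ B') (φ : Measuring C A B) :
    measuringEquiv adj C' A' B' (Measuring.comp c a b φ) =
      measuringTensorMap adj c a ≫ measuringEquiv adj C A B φ ≫ b := by
  rw [← Equiv.eq_symm_apply, ← measuringEquiv_symm_comp, Equiv.symm_apply_apply]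

/-- The isomorphism `μ_C(A, B) ≅ Alg(C ▷ A, B)`, natural in the three variables. -/
noncomputable def measuringIso : measuringFunctor F ≅ measuringTensorHomFunctor adj :=
  NatIso.ofComponents (fun C ↦ NatIso.ofComponents (fun A ↦ NatIso.ofComponents
    (fun B ↦ (measuringEquiv adj C.unop A.unop B).toIso)
    (fun {B B'} b ↦ by
      ext φ
      refine (measuringEquiv_comp adj (𝟙 _) (𝟙 _) b φ).trans ?_
      rw [measuringTensorMap_id, Category.id_comp]
      rfl))
    (fun {A A'} a ↦ by
      ext B φ
      refine (measuringEquiv_comp adj (𝟙 _) a.unop (𝟙 _) φ).trans ?_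
      rw [Category.comp_id]
      rfl))
    (fun {C C'} c ↦ by
      ext A B φ
      refine (measuringEquiv_comp adj c.unop (𝟙 _) (𝟙 _) φ).trans ?_
      rw [Category.comp_id]
      rfl)

end MeasuringTensor

theorem mainTheorem3 {𝒞 : Type u} [Category.{v} 𝒞] [MonoidalCategory 𝒞] [SymmetricCategory 𝒞]
    [IsLocallyPresentable.{v} 𝒞] (F : 𝒞 ⥤ 𝒞) [F.LaxBraided] [F.IsAccessible.{v}] :
    (Endofunctor.Algebra.forget F).IsRightAdjoint ∧
    ∀ (Fr : 𝒞 ⥤ Endofunctor.Algebra F) (adj : Fr ⊣ Endofunctor.Algebra.forget F),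
      ∃ _ : ∀ (C : Endofunctor.Coalgebra F) (A : Endofunctor.Algebra F),
          HasCoequalizer (freeStr Fr C A) (freeTwist adj C A),
        (∀ (C : Endofunctor.Coalgebra F) (A : Endofunctor.Algebra F),
          Nonempty ((((measuringFunctor F).obj (op C)).obj (op A)).CorepresentableBy
            (measuringTensor adj C A))) ∧
        ∃ e : measuringFunctor F ≅ measuringTensorHomFunctor adj,
          ∀ (C : Endofunctor.Coalgebra F) (A B : Endofunctor.Algebra F) (φ : Measuring C A B)
            (f : measuringTensor adj C A ⟶ B),
            ((e.hom.app (op C)).app (op A)).app B φ = f ↔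
              adj.homEquiv (C.V ⊗ A.a) B (measuringTensorπ adj C A ≫ f) = φ.hom := by
  -- Local presentability enters only through cocompleteness.
  obtain ⟨κ, _, _⟩ := IsLocallyPresentable.exists_cardinal.{v} 𝒞
  have : HasColimits 𝒞 := inferInstance
  have := Endofunctor.Algebra.hasColimits F
  refine ⟨Endofunctor.Algebra.isRightAdjoint_forget F, fun Fr adj ↦
    ⟨fun C A ↦ inferInstance, fun C A ↦ ⟨Functor.corepresentableByEquiv.symm
      (((measuringIso adj).app (op C)).app (op A)).symm⟩, measuringIso adj, fun C A B φ f ↦ ?_⟩⟩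
  refine ((measuringEquiv adj C A B).eq_symm_apply).symm.trans ⟨fun h ↦ ?_, fun h ↦ ?_⟩
  · rw [h, measuringEquiv_symm_hom]
  · exact Measuring.ext h.symm
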